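/- **Conventions.** Let $G$ be a finite connected simple graph without bridges, with edge set $E$, $|E|=d+1$ ($d\ge 0$). Let $\mathcal M(G)$ be its graphic matroid (ground set $E$, independent sets the edge sets of forests), $k$ its rank, $\mathcal B$ its set of bases, and $n=|\mathcal B|$. Let $\mathbb T^d=\mathbb R^{E}/\mathbb R(1,\dots,1)$ be the tropical torus with tropical addition $\min$ and tropical multiplication $+$, and let $\operatorname{tconv}$ be the tropical convex hull. For $B\in\mathcal B$ put $v_B=-e_B=\sum_{i\in B}-e_i\in\mathbb T^d$. The tropical matroid polytope of $\mathcal M(G)$ is $P=\operatorname{tconv}\{v_B : B\in\mathcal B\}$. For $i\in E$ let $\bar S_i=\{\xi\in\mathbb T^d : \xi_i=0,\ \xi_j\ge 0 \text{ for all } j\}$ (for a suitable representative $\xi$). The type of $x\in\mathbb T^d$ is $(T_i)_{i\in E}$ with $T_i=\{B\in\mathcal B : v_B\in x+\bar S_i\}$. The relatively open cell of type $T$ is the set of all points of type $T$. The cells of the tropical complex are the closures $X_T$ of the nonempty relatively open cells; the dimension of a cell is the dimension of its affine hull; the points of the zero-dimensional cells are the pseudovertices. A maximal bounded cell is an inclusion-maximal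 element among the bounded cells. The tropical vertices of $P$ are the elements of its inclusion-minimal generating set. Write $T^{(0)}$ for the type of the origin $\mathbf 0$. A sequence $i_1,\dots,i_{d-k+1}$ of distinct edges is *valid* if $E\setminus\{i_1,\dots,i_{d-k+1}\}$ contains a spanning tree of $G$. Write $e_{i_1\dots i_j}=e_{i_1}+\dots+e_{i_j}\in\mathbb T^d$, with $e_\emptyset=\mathbf 0$. **Lemma.** 1. Every maximal bounded cell has dimension $d-k+1$. 2. The maximal bounded cells are exactly the sets $\operatorname{tconv}(\mathbf 0,e_{i_1},e_{i_1i_2},\dots,e_{i_1\dots i_{d-k+1}})$ with $i_1,\dots,i_{d-k+1}$ a valid sequence. 3. For every valid sequence, all the points $\mathbf 0,e_{i_1},\dots,e_{i_1\dots i_{d-k+1}}$ are pseudovertices; $B=E\setminus\{i_1,\dots,i_{d-k+1}\}$ is a basis, the last point equals $v_B$, and it is a tropical vertex of $P$. Let $T$ be given by $$T_{i_j}=T^{(0)}_{i_j}\setminus\bigl(T^{(0)}_{i_1}\cup\dots\cup T^{(0)}_{i_{j-1}}\bigr)\quad(1\le j\le d-k+1),\qquad T_b=T^{(0)}_b\setminus\bigl(T^{(0)}_{i_1}\cup\dots\cup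 T^{(0)}_{i_{d-k+1}}\bigr)\quad(b\in B).$$ Then $X_T=\operatorname{tconv}(\mathbf 0,e_{i_1},\dots,e_{i_1\dots i_{d-k+1}})$, and the relatively open cell of type $T$ is the relative interior of this set. 4. There are exactly $n\cdot(d+1-k)!$ maximal bounded cells. -/

import Mathlib

open Set
open scoped Nat

/-! ### Tropical convexity in the tropical torus -/

/-- The tropical torus `ℝ^E / ℝ(1,…,1)`, with its quotient topology and quotient norm. -/
abbrev TropTorus (E : Type*) [Fintype E] : Type _ :=
  (E → ℝ) ⧸ Submodule.span ℝ {(1 : E → ℝ)}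

section Tropical

variable {E : Type*} [Fintype E]

/-- The class in the torus of a coordinate vector. -/
def toTorus (x : E → ℝ) : TropTorus E := Submodule.Quotient.mk x

/-- The (min-)tropical line segment: all `(a ⊙ x) ⊕ (b ⊙ y)`. -/
def tropSegment (p q : TropTorus E) : Set (TropTorus E) :=
  {r | ∃ (x y : E → ℝ) (a b : ℝ), toTorus x = p ∧ toTorus y = q ∧
    r = toTorus (fun e => min (a + x e) (b + y e))}

/-- A set is tropically convex if it contains the segment between any two of its points. -/
def IsTropConvex (S : Set (TropTorus E)) : Prop :=
  ∀ p ∈ S, ∀ q ∈ S, tropSegment p q ⊆ S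

/-- The tropical convex hull: the smallest tropically convex set containing `S`. -/
def tconv (S : Set (TropTorus E)) : Set (TropTorus E) :=
  ⋂₀ {C | IsTropConvex C ∧ S ⊆ C}

/-- `p` is a tropical vertex of `P`: it belongs to an inclusion-minimal generating set of `P`. -/
def IsTropVertex (P : Set (TropTorus E)) (p : TropTorus E) : Prop :=
  ∃ W : Set (TropTorus E), Minimal (fun W' => tconv W' = P) W ∧ p ∈ W

/-- The closed sector `S̄_e` of the tropical hyperplane with apex `0`. -/
def closedSector (e : E) : Set (TropTorus E) :=
  {p | ∃ x : E → ℝ, toTorus x = p ∧ x e = 0 ∧ ∀ f, 0 ≤ x f}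

variable {ι : Type*}

/-- The fine type of `x` with respect to the family `v`: its entry at `e` consists of the
indices `i` with `v i ∈ x + S̄_e`. -/
def fineType (v : ι → TropTorus E) (x : TropTorus E) : E → Set ι :=
  fun e => {i | v i ∈ (fun s => x + s) '' closedSector e}

/-- The relatively open cell of type `T`. -/
def openCell (v : ι → TropTorus E) (T : E → Set ι) : Set (TropTorus E) :=
  {x | fineType v x = T}

/-- The (closed) cells of the tropical complex of `v`: the closures of the nonempty
relatively open cells. -/
def IsCell (v : ι → TropTorus E) (C : Set (TropTorus E)) : Prop :=
  ∃ x : TropTorus E, C = closure (openCell v (fineType v x))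

/-- The inclusion-maximal elements among the bounded cells. -/
def IsMaxBoundedCell (v : ι → TropTorus E) (C : Set (TropTorus E)) : Prop :=
  Maximal (fun C' => IsCell v C' ∧ Bornology.IsBounded C') C

/-- The dimension of a cell: the dimension of its affine hull. -/
noncomputable def cellDim (C : Set (TropTorus E)) : ℕ :=
  Module.finrank ℝ (affineSpan ℝ C).direction

/-- A pseudovertex is (the point of) a zero-dimensional cell. -/
def IsPseudovertex (v : ι → TropTorus E) (p : TropTorus E) : Prop :=
  ∃ C, IsCell v C ∧ cellDim C = 0 ∧ p ∈ C

end Tropical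

/-! ### Graphic matroids and tropical matroid polytopes -/

section Graphic

variable {V : Type*}

/-- The spanning subgraph of `G` with edge set `F`. -/
def edgeSubgraph (G : SimpleGraph V) (F : Set G.edgeSet) : SimpleGraph V :=
  SimpleGraph.fromEdgeSet (Subtype.val '' F)

theorem edgeSubgraph_le (G : SimpleGraph V) (F : Set G.edgeSet) : edgeSubgraph G F ≤ G := by
  intro a b h
  rw [edgeSubgraph, SimpleGraph.fromEdgeSet_adj] at h
  obtain ⟨⟨e, -, he⟩, -⟩ := h
  have := e.2
  rwa [he] at this

theorem edgeSubgraph_mono (G : SimpleGraph V) {F F' : Set G.edgeSet} (h : F ⊆ F') :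
    edgeSubgraph G F ≤ edgeSubgraph G F' :=
  SimpleGraph.fromEdgeSet_mono (Set.image_mono h)

theorem edgeSubgraph_insert (G : SimpleGraph V) (F : Set G.edgeSet) (a b : V)
    (h : s(a, b) ∈ G.edgeSet) :
    edgeSubgraph G (insert ⟨s(a, b), h⟩ F) = edgeSubgraph G F ⊔ SimpleGraph.edge a b := by
  ext x y
  simp only [edgeSubgraph, SimpleGraph.edge, Set.image_insert_eq, SimpleGraph.sup_adj,
    SimpleGraph.fromEdgeSet_adj, Set.mem_insert_iff, Set.mem_singleton_iff]
  tauto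

theorem exists_edgeSubgraph_eq (G H : SimpleGraph V) (h : H ≤ G) :
    ∃ F : Set G.edgeSet, edgeSubgraph G F = H := by
  refine ⟨{e | e.1 ∈ H.edgeSet}, ?_⟩
  ext x y
  simp only [edgeSubgraph, SimpleGraph.fromEdgeSet_adj]
  constructor
  · rintro ⟨⟨e, he, hxy⟩, -⟩
    rw [Set.mem_ofPred_eq, hxy] at he
    exact he
  · intro hxy
    exact ⟨⟨⟨s(x, y), h hxy⟩, hxy, rfl⟩, hxy.ne⟩

theorem maximal_edgeSubgraph_iff (G : SimpleGraph V) (F : Set G.edgeSet) :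
    Maximal (fun F' => (edgeSubgraph G F').IsAcyclic) F ↔
      (edgeSubgraph G F).IsAcyclic ∧ (edgeSubgraph G F).Reachable = G.Reachable := by
  constructor
  · intro h
    refine ⟨h.1, ?_⟩
    rw [← SimpleGraph.maximal_isAcyclic_iff_reachable_eq (edgeSubgraph_le G F) h.1]
    refine ⟨⟨edgeSubgraph_le G F, h.1⟩, ?_⟩
    rintro H ⟨hH, hHa⟩ hFH
    have key : F ⊆ {e | e.1 ∈ H.edgeSet} := by
      rintro ⟨e, he⟩ heF
      induction e with | h a b =>
      refine hFH ?_
      rw [edgeSubgraph, SimpleGraph.fromEdgeSet_adj]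
      exact ⟨⟨_, heF, rfl⟩, SimpleGraph.Adj.ne he⟩
    obtain ⟨F', hF'⟩ := exists_edgeSubgraph_eq G H hH
    have hsub : F ⊆ F' := by
      rintro ⟨e, he⟩ heF
      induction e with | h a b =>
      have h1 : H.Adj a b := key heF
      rw [← hF', edgeSubgraph, SimpleGraph.fromEdgeSet_adj] at h1
      obtain ⟨⟨e', he', hee⟩, -⟩ := h1
      have : e' = ⟨s(a, b), he⟩ := Subtype.ext hee
      rwa [← this]
    have := h.2 (y := F') (by simpa only [hF'] using hHa) hsub
    rw [← hF']
    exact edgeSubgraph_mono G this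
  · rintro ⟨h1, h2⟩
    have hm := (SimpleGraph.maximal_isAcyclic_iff_reachable_eq (edgeSubgraph_le G F) h1).2 h2
    refine ⟨h1, ?_⟩
    intro F' hF' hFF'
    have hle := hm.2 (y := edgeSubgraph G F') ⟨edgeSubgraph_le G F', hF'⟩
      (edgeSubgraph_mono G hFF')
    rintro ⟨e, he⟩ heF
    induction e with | h a b =>
    have h3 : (edgeSubgraph G F).Adj a b := by
      refine hle ?_
      rw [edgeSubgraph, SimpleGraph.fromEdgeSet_adj]
      exact ⟨⟨_, heF, rfl⟩, SimpleGraph.Adj.ne he⟩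
    rw [edgeSubgraph, SimpleGraph.fromEdgeSet_adj] at h3
    obtain ⟨⟨e', he', hee⟩, -⟩ := h3
    have : e' = ⟨s(a, b), he⟩ := Subtype.ext hee
    rwa [← this]

/-- The graphic matroid of `G`: the ground set is the set of all edges, and the independent
sets are the (edge sets of) forests. -/
def graphicMatroid (G : SimpleGraph V) [Finite G.edgeSet] : Matroid G.edgeSet :=
  (IndepMatroid.ofBdd (E := Set.univ) (Indep := fun F => (edgeSubgraph G F).IsAcyclic)
    (indep_empty := by simp [edgeSubgraph])
    (indep_subset := fun _ _ hJ hIJ => hJ.anti (edgeSubgraph_mono G hIJ))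
    (indep_aug := by
      intro I B hI hnot hB
      by_contra hcon
      push Not at hcon
      rw [maximal_edgeSubgraph_iff] at hB
      apply hnot
      rw [maximal_edgeSubgraph_iff]
      refine ⟨hI, ?_⟩
      have hadj : ∀ a b, (edgeSubgraph G B).Adj a b → (edgeSubgraph G I).Reachable a b := by
        intro a b hab
        have hG : s(a, b) ∈ G.edgeSet := edgeSubgraph_le G B hab
        by_contra hr
        have hmem : (⟨s(a, b), hG⟩ : G.edgeSet) ∈ B \ I := by
          constructor
          · rw [edgeSubgraph, SimpleGraph.fromEdgeSet_adj] at hab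
            obtain ⟨⟨e', he', hee⟩, -⟩ := hab
            have : e' = ⟨s(a, b), hG⟩ := Subtype.ext hee
            rwa [← this]
          · intro hmI
            apply hr
            refine SimpleGraph.Adj.reachable ?_
            rw [edgeSubgraph, SimpleGraph.fromEdgeSet_adj]
            exact ⟨⟨_, hmI, rfl⟩, hab.ne⟩
        apply hcon _ hmem
        rw [edgeSubgraph_insert]
        exact hI.sup_edge_of_not_reachable hr
      funext x y
      apply propext
      constructor
      · exact fun h => h.mono (edgeSubgraph_le G I)
      · intro h
        rw [← hB.2] at h
        obtain ⟨w⟩ := h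
        induction w with
        | nil => exact SimpleGraph.Reachable.refl _
        | cons h' _ ih => exact (hadj _ _ h').trans ih)
    (subset_ground := fun _ _ => Set.subset_univ _)
    (indep_bdd := ⟨Nat.card G.edgeSet, fun I _ => by
      rw [← Set.ncard_univ, Set.Finite.cast_ncard_eq Set.finite_univ]
      exact Set.encard_mono (Set.subset_univ I)⟩)).matroid

/-- The bases of the matroid `M`, used as an index type. -/
abbrev BasesOf {E : Type*} (M : Matroid E) : Type _ := {B : Set E // M.IsBase B}

/-- The generators `v_B = -e_B = ∑_{i ∈ B} -e_i` of the tropical matroid polytope of `M`. -/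
noncomputable def matroidGen {E : Type*} [Fintype E] (M : Matroid E) (B : BasesOf M) :
    TropTorus E :=
  toTorus (-(B.1.indicator 1))

/-- The tropical matroid polytope of `M`. -/
noncomputable def tropMatroidPolytope {E : Type*} [Fintype E] (M : Matroid E) :
    Set (TropTorus E) :=
  tconv (Set.range (matroidGen M))

/-- The point `e_{i_1,…,i_j}`, the class of the sum of the unit vectors of the first `j`
members of the sequence `i`. -/
noncomputable def seqPoint {E : Type*} [Fintype E] {r : ℕ} (i : Fin r → E) (j : Fin (r + 1)) :
    TropTorus E :=
  toTorus ({e | ∃ l : Fin r, l.val < j.val ∧ i l = e}.indicator 1)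

/-- A sequence of distinct edges is valid if the remaining edges contain a spanning tree. -/
def IsValidSeq (G : SimpleGraph V) {r : ℕ} (i : Fin r → G.edgeSet) : Prop :=
  Function.Injective i ∧ ∃ F : Set G.edgeSet, F ⊆ (Set.range i)ᶜ ∧ (edgeSubgraph G F).IsTree

end Graphic

/-!
A generator `v_B = -e_B` belongs to the type entry `T_e` of a point `x` exactly when `e` maximizes
`f ↦ x_f + [f ∈ B]`. All the sets involved are therefore cut out by inequalities between the
functionals `coordDiff e f : x ↦ x_e - x_f` on the torus.

Two general facts hold for any family of generators. The closure of the cell of `p` consists of the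
points whose type contains that of `p` (`closure_openCell_fineType`): on the way from such a point
to `p`, the maximizers become those of `p` at once. And a bounded cell has only nonempty type
entries (`fineType_nonempty_of_isBounded`), as otherwise a coordinate could be decreased forever.

For a matroid, nonempty entries mean that, normalizing the least coordinate of `x` to `0`, the zero
set of `x` contains a basis `B` and all coordinates are at most `1`. Listing the complement of `B`
as `i_1, …, i_r` by decreasing coordinates gives `1 ≥ x_{i_1} ≥ … ≥ x_{i_r} ≥ 0 = x_b`, that is, a
point of an order simplex (`orderSimplex`, for the heights `seqHeight i`), which is the tropical
hull of `0, e_{i_1}, …, e_{i_1 … i_r}` (`tconv_range_seqPoint`). So each bounded cell lies in an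
order simplex (`exists_mem_orderSimplex_seqHeight`).

Conversely an order simplex is a bounded cell (`closure_openCell_heightPoint`), whose relatively
open cell is its relative interior (`openCell_heightPoint`, `intrinsicInterior_orderSimplex`). Here
the simplicity of the matroid enters: any two elements `e`, `f` extend to a basis inside
`B ∪ {e, f}`, and the entries to which this basis belongs detect the order of `x_e` and `x_f`. As
no order simplex contains another (`seq_eq_of_orderSimplex_subset`), they are the maximal bounded
cells (`isMaxBoundedCell_iff`), and they correspond to the enumerations of the complements of bases
(`card_seq_isBase_compl`). For the graphic matroid of a connected graph, bases are spanning trees,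
and simplicity says that a cycle has at least three edges.
-/

/-! ### Coordinate differences on the tropical torus -/

section Tropical

variable {E : Type*} [Fintype E]

theorem toTorus_surjective : Function.Surjective (toTorus (E := E)) :=
  Submodule.Quotient.mk_surjective _

theorem toTorus_eq_iff {x y : E → ℝ} : toTorus x = toTorus y ↔ ∃ c : ℝ, ∀ e, x e = y e + c := by
  unfold toTorus
  rw [Submodule.Quotient.eq, Submodule.mem_span_singleton]
  refine exists_congr fun c => ?_
  rw [funext_iff]
  refine forall_congr' fun e => ?_
  simp only [Pi.smul_apply, Pi.one_apply, smul_eq_mul, mul_one, Pi.sub_apply]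
  constructor <;> intro h <;> linarith

/-- The functional `x ↦ x_e - x_f`, which is well defined on the torus. These functionals
separate points, and every set in sight is cut out by inequalities between them. -/
noncomputable def coordDiff (e f : E) : TropTorus E →L[ℝ] ℝ where
  toLinearMap := Submodule.liftQ _
    { toFun := fun x : E → ℝ => x e - x f
      map_add' := fun x y => add_sub_add_comm _ _ _ _
      map_smul' := fun c x => (mul_sub c _ _).symm } (by
      rw [Submodule.span_singleton_le_iff_mem, LinearMap.mem_ker]
      exact sub_self (1 : ℝ))
  cont := by
    refine (Submodule.isQuotientMap_mkQ _).continuous_iff.2 ?_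
    change Continuous fun x : E → ℝ => x e - x f
    fun_prop

@[simp]
theorem coordDiff_toTorus (e f : E) (x : E → ℝ) : coordDiff e f (toTorus x) = x e - x f := rfl

theorem coordDiff_add_coordDiff (e f g : E) (p : TropTorus E) :
    coordDiff e f p + coordDiff f g p = coordDiff e g p := by
  obtain ⟨x, rfl⟩ := toTorus_surjective p
  simp

theorem coordDiff_swap (e f : E) (p : TropTorus E) : coordDiff f e p = -coordDiff e f p := by
  obtain ⟨x, rfl⟩ := toTorus_surjective p
  simp

theorem torus_ext {p q : TropTorus E} (f : E)
    (h : ∀ e, coordDiff e f p = coordDiff e f q) : p = q := by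
  obtain ⟨x, rfl⟩ := toTorus_surjective p
  obtain ⟨y, rfl⟩ := toTorus_surjective q
  refine toTorus_eq_iff.2 ⟨x f - y f, fun e => ?_⟩
  have := h e
  simp only [coordDiff_toTorus] at this
  linarith

theorem isBounded_of_coordDiff_le_one [Nonempty E] {S : Set (TropTorus E)}
    (h : ∀ p ∈ S, ∀ e f, coordDiff e f p ≤ 1) : Bornology.IsBounded S := by
  refine isBounded_iff_forall_norm_le.2 ⟨1, fun p hp => ?_⟩
  obtain ⟨x, rfl⟩ := toTorus_surjective p
  obtain ⟨f⟩ := ‹Nonempty E›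
  have hx : toTorus x = toTorus (fun e => x e - x f) :=
    toTorus_eq_iff.2 ⟨x f, fun e => by ring⟩
  rw [hx]
  refine (Submodule.Quotient.norm_mk_le _ _).trans ?_
  refine (pi_norm_le_iff_of_nonneg zero_le_one).2 fun e => ?_
  have h1 := h _ hp e f
  have h2 := h _ hp f e
  simp only [coordDiff_toTorus] at h1 h2
  rw [Real.norm_eq_abs, abs_le]
  constructor <;> linarith

/-! ### Types and cells -/

theorem mem_closedSector_iff {e : E} {p : TropTorus E} :
    p ∈ closedSector e ↔ ∀ f, 0 ≤ coordDiff f e p := by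
  constructor
  · rintro ⟨x, rfl, h0, hx⟩ f
    simpa [h0] using hx f
  · intro h
    obtain ⟨x, rfl⟩ := toTorus_surjective p
    exact ⟨fun f => x f - x e, toTorus_eq_iff.2 ⟨-x e, fun f => by ring⟩, by simp,
      fun f => by simpa using h f⟩

variable {ι : Type*} {v : ι → TropTorus E}

theorem mem_fineType_iff {p : TropTorus E} {e : E} {i : ι} :
    i ∈ fineType v p e ↔ ∀ f, coordDiff f e p ≤ coordDiff f e (v i) := by
  have : i ∈ fineType v p e ↔ v i - p ∈ closedSector e := by
    constructor
    · rintro ⟨s, hs, h⟩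
      simp only at h
      rwa [← h, add_sub_cancel_left]
    · exact fun h => ⟨_, h, add_sub_cancel _ _⟩
  rw [this, mem_closedSector_iff]
  simp only [map_sub, sub_nonneg]

/-- Every generator lies in some closed sector based at `p`. -/
theorem exists_mem_fineType [Nonempty E] (v : ι → TropTorus E) (p : TropTorus E) (i : ι) :
    ∃ e, i ∈ fineType v p e := by
  obtain ⟨x, hx⟩ := toTorus_surjective (p - v i)
  obtain ⟨e, he⟩ := Finite.exists_max x
  refine ⟨e, mem_fineType_iff.2 fun f => ?_⟩
  have : coordDiff f e (p - v i) ≤ 0 := by rw [← hx]; simpa using he f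
  rwa [map_sub, sub_nonpos] at this

/-- Moving from a point `q` towards a point `p` whose type is contained in that of `q`, the type
becomes that of `p` at once: the maximizers of a proper convex combination of two functions with
nested sets of maximizers are the maximizers of the function with the smaller set. -/
theorem fineType_lineMap [Nonempty E] {p q : TropTorus E}
    (h : ∀ e, fineType v p e ⊆ fineType v q e) {t : ℝ} (h0 : 0 < t) (h1 : t ≤ 1) :
    fineType v (AffineMap.lineMap q p t) = fineType v p := by
  have key : ∀ e f, coordDiff e f (AffineMap.lineMap q p t : TropTorus E) =
      (1 - t) * coordDiff e f q + t * coordDiff e f p := by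
    intro e f
    rw [AffineMap.lineMap_apply_module]
    simp
  ext e i
  constructor
  · -- An index `e'` that is maximal at `p`, hence also at `q`, ties with `e` on the segment, and
    -- therefore at `p`.
    intro hi
    obtain ⟨e', he'⟩ := exists_mem_fineType v p i
    have hq := h _ he'
    rw [mem_fineType_iff] at hi he' hq ⊢
    have a1 := hi e'
    rw [key] at a1
    have a2 := he' e
    have a3 := hq e
    rw [coordDiff_swap e' e, coordDiff_swap e' e] at a2 a3
    have a4 : coordDiff e' e p ≤ coordDiff e' e (v i) := by
      have : t * coordDiff e' e p ≤ t * coordDiff e' e (v i) := by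
        nlinarith [mul_le_mul_of_nonneg_left a3 (sub_nonneg.2 h1)]
      exact le_of_mul_le_mul_left this h0
    intro f
    rw [← coordDiff_add_coordDiff f e' e p, ← coordDiff_add_coordDiff f e' e (v i)]
    exact add_le_add (he' f) a4
  · intro hi
    have hq := h _ hi
    rw [mem_fineType_iff] at hi hq ⊢
    intro f
    rw [key]
    nlinarith [mul_le_mul_of_nonneg_left (hq f) (sub_nonneg.2 h1),
      mul_le_mul_of_nonneg_left (hi f) h0.le]

theorem closure_openCell_fineType [Nonempty E] (v : ι → TropTorus E) (p : TropTorus E) :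
    closure (openCell v (fineType v p)) = {q | ∀ e, fineType v p e ⊆ fineType v q e} := by
  refine Subset.antisymm ?_ ?_
  · refine closure_minimal ?_ ?_
    · intro q hq e
      rw [show fineType v q = fineType v p from hq]
    · simp only [subset_def, mem_fineType_iff, ofPred_forall]
      refine isClosed_iInter fun e => isClosed_iInter fun i => isClosed_iInter fun _ =>
        isClosed_iInter fun f => isClosed_le (coordDiff f e).continuous continuous_const
  · intro q hq
    have hc : Filter.Tendsto (fun t : ℝ => (AffineMap.lineMap q p t : TropTorus E))
        (nhdsWithin 0 (Ioi 0)) (nhds q) := by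
      have : Continuous fun t : ℝ => (AffineMap.lineMap q p t : TropTorus E) := by
        simp only [AffineMap.lineMap_apply_module]
        fun_prop
      have h2 := this.tendsto 0
      rw [AffineMap.lineMap_apply_zero] at h2
      exact h2.mono_left nhdsWithin_le_nhds
    refine mem_closure_of_tendsto hc ?_
    filter_upwards [Ioc_mem_nhdsGT (zero_lt_one' ℝ)] with t ht
    exact fineType_lineMap hq ht.1 ht.2

/-- If no generator lies in the sector at `p` in direction `e`, then `x_e` can be decreased
indefinitely within the cell of `p`. -/
theorem fineType_nonempty_of_isBounded [Nonempty E] [Nonempty ι] {p : TropTorus E}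
    (h : Bornology.IsBounded (openCell v (fineType v p))) (e : E) : (fineType v p e).Nonempty := by
  classical
  by_contra hne
  rw [not_nonempty_iff_eq_empty] at hne
  obtain ⟨i⟩ := ‹Nonempty ι›
  obtain ⟨g, hg⟩ := exists_mem_fineType v p i
  have hge : g ≠ e := by
    rintro rfl
    rw [hne] at hg
    exact hg
  -- Moving in direction `-e_e` never changes the type.
  let u : TropTorus E := toTorus (-Pi.single e 1)
  have hu1 : ∀ f, f ≠ e → coordDiff f e u = 1 := fun f hf => by simp [u, hf]
  have hu2 : ∀ f f', f ≠ e → f' ≠ e → coordDiff f f' u = 0 := fun f f' hf hf' => by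
    simp [u, hf, hf']
  have hu3 : ∀ f, f ≠ e → coordDiff e f u = -1 := fun f hf => by simp [u, hf]
  have hmem : ∀ t : ℝ, 0 ≤ t → p + t • u ∈ openCell v (fineType v p) := by
    intro t ht
    have key : ∀ a b, coordDiff a b (p + t • u) = coordDiff a b p + t * coordDiff a b u := by
      intro a b
      simp
    change fineType v (p + t • u) = fineType v p
    ext a j
    rw [mem_fineType_iff, mem_fineType_iff]
    simp only [key]
    by_cases hae : a = e
    · subst hae
      have : j ∉ fineType v p a := by rw [hne]; exact notMem_empty j
      rw [mem_fineType_iff] at this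
      refine iff_of_false (fun hj => this fun f => ?_) this
      by_cases hf : f = a
      · subst hf
        have := hj f
        obtain ⟨x, hx⟩ := toTorus_surjective p
        obtain ⟨y, hy⟩ := toTorus_surjective (v j)
        simp [← hx, ← hy]
      · have := hj f
        rw [hu1 f hf] at this
        linarith
    · constructor
      · intro hj f
        by_cases hf : f = e
        · subst hf
          obtain ⟨b, hb⟩ := exists_mem_fineType v p j
          have hbe : b ≠ f := by
            rintro rfl
            rw [hne] at hb
            exact hb
          rw [mem_fineType_iff] at hb
          have h1 := hj b
          rw [hu2 b a hbe hae] at h1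
          have h2 := hb f
          rw [← coordDiff_add_coordDiff f b a p, ← coordDiff_add_coordDiff f b a (v j)]
          linarith
        · have := hj f
          rw [hu2 f a hf hae] at this
          linarith
      · intro hj f
        by_cases hf : f = e
        · subst hf
          rw [hu3 a hae]
          have := hj f
          linarith
        · rw [hu2 f a hf hae]
          have := hj f
          linarith
  have hb := (coordDiff g e).lipschitz.isBounded_image h
  obtain ⟨C, hC⟩ := isBounded_iff_forall_norm_le.1 hb
  have hC' : ∀ t : ℝ, 0 ≤ t → coordDiff g e p + t ≤ C := by
    intro t ht
    have := (le_abs_self _).trans (hC _ ⟨_, hmem t ht, rfl⟩)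
    simpa [hu1 g hge] using this
  have h1 := hC' (|C| + |coordDiff g e p| + 1) (by positivity)
  have h2 := le_abs_self C
  have h3 := neg_abs_le (coordDiff g e p)
  linarith

/-! ### Tropical convexity -/

theorem subset_tconv (S : Set (TropTorus E)) : S ⊆ tconv S :=
  subset_sInter fun _ h => h.2

theorem tconv_subset {S C : Set (TropTorus E)} (hC : IsTropConvex C) (h : S ⊆ C) : tconv S ⊆ C :=
  sInter_subset_of_mem ⟨hC, h⟩

theorem isTropConvex_tconv (S : Set (TropTorus E)) : IsTropConvex (tconv S) := by
  intro p hp q hq r hr C hC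
  exact hC.1 p (hp C hC) q (hq C hC) hr

/-- A tropically convex set is closed under finite tropical linear combinations. -/
theorem IsTropConvex.inf'_mem {κ : Type*} {C : Set (TropTorus E)} (hC : IsTropConvex C)
    {s : Finset κ} (hs : s.Nonempty) (c : κ → ℝ) (x : κ → E → ℝ) (h : ∀ j ∈ s, toTorus (x j) ∈ C) :
    toTorus (fun e => s.inf' hs fun j => c j + x j e) ∈ C := by
  classical
  induction hs using Finset.Nonempty.cons_induction with
  | singleton a =>
    have : toTorus (fun e => c a + x a e) = toTorus (x a) :=
      toTorus_eq_iff.2 ⟨c a, fun e => add_comm _ _⟩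
    simpa [this] using h a
  | cons a s ha hs ih =>
    refine hC _ (h a (Finset.mem_cons_self _ _)) _
      (ih fun j hj => h j (Finset.mem_cons_of_mem hj)) ?_
    refine ⟨x a, _, c a, 0, rfl, rfl, ?_⟩
    congr 1
    ext e
    rw [Finset.inf'_cons hs, zero_add]

theorem isTropConvex_coordDiff_le (e f : E) (c : ℝ) :
    IsTropConvex {p : TropTorus E | coordDiff e f p ≤ c} := by
  rintro _ hp _ hq _ ⟨x, y, a, b, rfl, rfl, rfl⟩
  simp only [mem_ofPred_eq, coordDiff_toTorus] at *
  rw [sub_le_iff_le_add, ← min_add_add_left]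
  refine le_min ?_ ?_
  · exact (min_le_left _ _).trans (by linarith)
  · exact (min_le_right _ _).trans (by linarith)

theorem isTropConvex_iInter {κ : Sort*} {C : κ → Set (TropTorus E)}
    (h : ∀ j, IsTropConvex (C j)) : IsTropConvex (⋂ j, C j) := by
  intro p hp q hq r hr
  rw [mem_iInter] at *
  exact fun j => h j p (hp j) q (hq j) hr

/-- The complement of a closed sector is tropically convex. -/
theorem isTropConvex_exists_coordDiff_lt (e : E) (c : E → ℝ) :
    IsTropConvex {p : TropTorus E | ∃ f, coordDiff f e p < c f} := by
  rintro _ ⟨f, hf⟩ _ ⟨g, hg⟩ _ ⟨x, y, a, b, rfl, rfl, rfl⟩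
  simp only [mem_ofPred_eq, coordDiff_toTorus] at *
  rcases le_total (a + x e) (b + y e) with h | h
  · refine ⟨f, ?_⟩
    rw [min_eq_left h]
    have := min_le_left (a + x f) (b + y f)
    linarith
  · refine ⟨g, ?_⟩
    rw [min_eq_right h]
    have := min_le_right (a + x g) (b + y g)
    linarith

end Tropical

/-! ### Order simplices -/

section OrderSimplex

variable {E : Type*} [Fintype E]

/-- The points of the torus whose coordinates are weakly ordered as the heights `h` and differ
by at most `1`. If some height is `0`, these are the classes of the `x` with
`0 ≤ x_e ≤ 1`, with `x_e = 0` at height `0`, and with `x` weakly increasing in `h`. -/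
def orderSimplex (h : E → ℕ) : Set (TropTorus E) :=
  {p | (∀ e f, h e ≤ h f → coordDiff e f p ≤ 0) ∧ ∀ e f, coordDiff e f p ≤ 1}

/-- The points of the order simplex at which the inequalities between coordinates of different
heights, and the bounds by `1`, are strict. -/
def openOrderSimplex (h : E → ℕ) : Set (TropTorus E) :=
  {p | (∀ e f, h e ≤ h f → coordDiff e f p ≤ 0) ∧ (∀ e f, h e < h f → coordDiff e f p < 0) ∧
    ∀ e f, coordDiff e f p < 1}

/-- A point of the open order simplex: the heights themselves, scaled down. -/
noncomputable def heightPoint (h : E → ℕ) : TropTorus E :=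
  toTorus fun e => (h e : ℝ) / (∑ f, (h f : ℝ) + 1)

theorem coordDiff_heightPoint (h : E → ℕ) (e f : E) :
    coordDiff e f (heightPoint h) = ((h e : ℝ) - h f) / (∑ f, (h f : ℝ) + 1) := by
  rw [heightPoint, coordDiff_toTorus, sub_div]

theorem heightPoint_denom_pos (h : E → ℕ) : (0 : ℝ) < ∑ f, (h f : ℝ) + 1 := by positivity

theorem coordDiff_heightPoint_nonpos_iff (h : E → ℕ) {e f : E} :
    coordDiff e f (heightPoint h) ≤ 0 ↔ h e ≤ h f := by
  rw [coordDiff_heightPoint, div_le_iff₀ (heightPoint_denom_pos h), zero_mul, sub_nonpos,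
    Nat.cast_le]

theorem heightPoint_mem_openOrderSimplex (h : E → ℕ) : heightPoint h ∈ openOrderSimplex h := by
  refine ⟨fun e f hef => (coordDiff_heightPoint_nonpos_iff h).2 hef, fun e f hef => ?_,
    fun e f => ?_⟩
  · rw [coordDiff_heightPoint, div_lt_iff₀ (heightPoint_denom_pos h), zero_mul, sub_neg,
      Nat.cast_lt]
    exact hef
  · rw [coordDiff_heightPoint, div_lt_one (heightPoint_denom_pos h)]
    have h1 : (h e : ℝ) ≤ ∑ f, (h f : ℝ) :=
      Finset.single_le_sum (f := fun f => (h f : ℝ)) (fun _ _ => Nat.cast_nonneg _)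
        (Finset.mem_univ e)
    have h2 : (0 : ℝ) ≤ h f := Nat.cast_nonneg _
    linarith

theorem openOrderSimplex_subset (h : E → ℕ) : openOrderSimplex h ⊆ orderSimplex h :=
  fun _ hp => ⟨hp.1, fun e f => (hp.2.2 e f).le⟩

theorem isTropConvex_orderSimplex (h : E → ℕ) : IsTropConvex (orderSimplex h) := by
  have : orderSimplex h = (⋂ e, ⋂ f, ⋂ _ : h e ≤ h f, {p | coordDiff e f p ≤ 0}) ∩
      ⋂ e, ⋂ f, {p | coordDiff e f p ≤ 1} := by
    ext p
    simp [orderSimplex]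
  rw [this]
  have h1 : IsTropConvex (⋂ e, ⋂ f, ⋂ _ : h e ≤ h f, {p | coordDiff e f p ≤ 0}) :=
    isTropConvex_iInter fun e => isTropConvex_iInter fun f => isTropConvex_iInter fun _ =>
      isTropConvex_coordDiff_le e f 0
  have h2 : IsTropConvex (⋂ e, ⋂ f, {p : TropTorus E | coordDiff e f p ≤ 1}) :=
    isTropConvex_iInter fun e => isTropConvex_iInter fun f => isTropConvex_coordDiff_le e f 1
  exact fun p hp q hq r hr => ⟨h1 p hp.1 q hq.1 hr, h2 p hp.2 q hq.2 hr⟩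

/-- The indicators of upper sets are the vertices of the order simplex. -/
theorem indicator_upper_mem_orderSimplex (h : E → ℕ) {S : Set E}
    (hS : ∀ e f, h e ≤ h f → e ∈ S → f ∈ S) :
    toTorus (S.indicator 1) ∈ orderSimplex h := by
  classical
  constructor
  · intro e f hef
    rw [coordDiff_toTorus, sub_nonpos]
    by_cases he : e ∈ S
    · simp [he, hS e f hef he]
    · rw [indicator_of_notMem he]
      exact indicator_nonneg (fun _ _ => zero_le_one) _
  · intro e f
    rw [coordDiff_toTorus]
    have h1 : S.indicator (1 : E → ℝ) e ≤ 1 :=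
      indicator_le_self' (f := (1 : E → ℝ)) (fun _ _ => zero_le_one) e
    have h2 : 0 ≤ S.indicator (1 : E → ℝ) f := indicator_nonneg (fun _ _ => zero_le_one) _
    linarith

/-- An order simplex is the tropical hull of the indicators of the sets `{e | h f < h e}`: a point
`x` of it is the tropical combination of them with coefficients `x_f`, since
`x_e = min_f (x_f + [h f < h e])` with the minimum attained at `f = e`. -/
theorem orderSimplex_eq_tconv [Nonempty E] (h : E → ℕ) :
    orderSimplex h = tconv (range fun f => toTorus ({e | h f < h e}.indicator 1)) := by
  refine Subset.antisymm ?_ (tconv_subset (isTropConvex_orderSimplex h) ?_)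
  · intro p hp
    obtain ⟨x, rfl⟩ := toTorus_surjective p
    have hmem := (isTropConvex_tconv
        (range fun f => toTorus ({e | h f < h e}.indicator 1))).inf'_mem
      (Finset.univ_nonempty (α := E)) x (fun f => {e | h f < h e}.indicator 1)
      fun j _ => subset_tconv _ ⟨j, rfl⟩
    have hx : x = fun e => Finset.univ.inf' Finset.univ_nonempty
        fun f => x f + {e | h f < h e}.indicator (1 : E → ℝ) e := by
      ext e
      refine le_antisymm (Finset.le_inf' _ _ fun f _ => ?_) ?_
      · by_cases hef : h f < h e
        · rw [indicator_of_mem (by exact hef)]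
          have := hp.2 e f
          simp only [coordDiff_toTorus, Pi.one_apply] at *
          linarith
        · rw [indicator_of_notMem (by exact hef)]
          have := hp.1 e f (not_lt.1 hef)
          simp only [coordDiff_toTorus] at *
          linarith
      · refine (Finset.inf'_le _ (Finset.mem_univ e)).trans ?_
        simp
    rw [hx]
    exact hmem
  · rintro _ ⟨f, rfl⟩
    exact indicator_upper_mem_orderSimplex h fun a b hab (ha : _ < _) => ha.trans_le hab

theorem intrinsicInterior_orderSimplex (h : E → ℕ) :
    intrinsicInterior ℝ (orderSimplex h) = openOrderSimplex h := by
  ext p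
  rw [mem_intrinsicInterior]
  constructor
  · -- Step slightly beyond `p` on the ray from the height point through `p`.
    rintro ⟨y, hy, rfl⟩
    have hz := heightPoint_mem_openOrderSimplex h
    have hzA : heightPoint h ∈ affineSpan ℝ (orderSimplex h) :=
      subset_affineSpan ℝ _ (openOrderSimplex_subset h hz)
    let γ : ℝ → affineSpan ℝ (orderSimplex h) := fun t =>
      ⟨AffineMap.lineMap (heightPoint h) (y : TropTorus E) (1 + t),
        AffineMap.lineMap_mem _ hzA y.2⟩
    have hγ : Continuous γ := by
      refine Continuous.subtype_mk ?_ _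
      simp only [AffineMap.lineMap_apply_module]
      fun_prop
    have hγ0 : γ 0 = y := by
      apply Subtype.ext
      simp [γ]
    have hev : ∀ᶠ t in nhdsWithin (0 : ℝ) (Ioi 0), γ t ∈ Subtype.val ⁻¹' orderSimplex h := by
      refine (hγ.tendsto 0).mono_left nhdsWithin_le_nhds ?_
      rw [hγ0]
      exact mem_interior_iff_mem_nhds.1 hy
    obtain ⟨t, ht, ht0 : 0 < t⟩ := (hev.and self_mem_nhdsWithin).exists
    have key : ∀ e f, coordDiff e f (γ t : TropTorus E) =
        (1 + t) * coordDiff e f (y : TropTorus E) - t * coordDiff e f (heightPoint h) := by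
      intro e f
      simp only [γ, AffineMap.lineMap_apply_module, map_add, map_smul, smul_eq_mul]
      ring
    have hyS : y ∈ Subtype.val ⁻¹' orderSimplex h := interior_subset hy
    refine ⟨hyS.1, fun e f hef => ?_, fun e f => ?_⟩
    · have h1 := ht.1 e f hef.le
      rw [key] at h1
      have h2 := mul_neg_of_pos_of_neg ht0 (hz.2.1 e f hef)
      by_contra hcon
      have := mul_nonneg (by linarith : 0 ≤ 1 + t) (not_lt.1 hcon)
      linarith
    · have h1 := ht.2 e f
      rw [key] at h1
      have h2 := mul_lt_mul_of_pos_left (hz.2.2 e f) ht0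
      by_contra hcon
      have := mul_le_mul_of_nonneg_left (not_lt.1 hcon) (by linarith : 0 ≤ 1 + t)
      linarith
  · intro hp
    -- On the affine hull, coordinates of equal height agree.
    let K : Submodule ℝ (TropTorus E) :=
      ⨅ e, ⨅ f, ⨅ _ : h e = h f, LinearMap.ker (coordDiff e f).toLinearMap
    have hK : ∀ q, q ∈ K ↔ ∀ e f, h e = h f → coordDiff e f q = 0 := by
      intro q
      simp [K, Submodule.mem_iInf]
    have hspan : affineSpan ℝ (orderSimplex h) ≤ K.toAffineSubspace := by
      refine affineSpan_le.2 fun q hq => (hK q).2 fun e f hef => le_antisymm (hq.1 e f hef.le) ?_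
      have := hq.1 f e hef.ge
      rw [coordDiff_swap] at this
      linarith
    let U : Set (TropTorus E) := (⋂ e, ⋂ f, ⋂ _ : h e < h f, {q | coordDiff e f q < 0}) ∩
      ⋂ e, ⋂ f, {q | coordDiff e f q < 1}
    have hU : IsOpen U :=
      (isOpen_iInter_of_finite fun e => isOpen_iInter_of_finite fun f =>
        isOpen_iInter_of_finite fun _ =>
          isOpen_lt (coordDiff e f).continuous continuous_const).inter
      (isOpen_iInter_of_finite fun e => isOpen_iInter_of_finite fun f =>
        isOpen_lt (coordDiff e f).continuous continuous_const)
    have hmemU : ∀ q, q ∈ U ↔ (∀ e f, h e < h f → coordDiff e f q < 0) ∧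
        ∀ e f, coordDiff e f q < 1 := by
      intro q
      simp [U]
    refine ⟨⟨p, subset_affineSpan ℝ _ (openOrderSimplex_subset h hp)⟩, ?_, rfl⟩
    refine mem_interior.2 ⟨Subtype.val ⁻¹' U, ?_, hU.preimage continuous_subtype_val,
      (hmemU p).2 hp.2⟩
    rintro ⟨q, hqA⟩ hqU
    have hq := (hmemU q).1 hqU
    refine ⟨fun e f hef => ?_, fun e f => (hq.2 e f).le⟩
    rcases hef.lt_or_eq with hlt | heq
    · exact (hq.1 e f hlt).le
    · exact ((hK q).1 (hspan hqA) e f heq).le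

/-- Coordinates with respect to the unit vectors of positive height, the coordinates of height `0`
being zero. -/
noncomputable def extendByZero (h : E → ℕ) : ({e // h e ≠ 0} → ℝ) →ₗ[ℝ] TropTorus E :=
  (Submodule.mkQ _).comp (LinearMap.pi fun e =>
    if he : h e ≠ 0 then LinearMap.proj (⟨e, he⟩ : {e // h e ≠ 0}) else 0)

theorem coordDiff_extendByZero (h : E → ℕ) {f : E} (hf : h f = 0) (c : {e // h e ≠ 0} → ℝ)
    (e : E) : coordDiff e f (extendByZero h c) = if he : h e ≠ 0 then c ⟨e, he⟩ else 0 := by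
  have : extendByZero h c = toTorus fun e => if he : h e ≠ 0 then c ⟨e, he⟩ else 0 := by
    refine congrArg toTorus (funext fun e => ?_)
    by_cases he : h e ≠ 0
    · simp [he]
    · rw [not_not] at he
      simp [he]
  rw [this, coordDiff_toTorus]
  simp [hf]

theorem cellDim_orderSimplex {h : E → ℕ} (h0 : ∃ e, h e = 0)
    (hinj : ∀ e f, h e = h f → h e ≠ 0 → e = f) :
    cellDim (orderSimplex h) = Nat.card {e // h e ≠ 0} := by
  classical
  obtain ⟨f, hf⟩ := h0
  have hL : Function.Injective (extendByZero h) := by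
    intro c c' hcc
    ext ⟨e, he⟩
    have := congrArg (coordDiff e f) hcc
    simpa only [coordDiff_extendByZero h hf, dif_pos he] using this
  have hsub : ∀ p ∈ orderSimplex h, p ∈ LinearMap.range (extendByZero h) := by
    intro p hp
    refine ⟨fun e => coordDiff e.1 f p, torus_ext f fun e => ?_⟩
    rw [coordDiff_extendByZero h hf]
    split_ifs with he
    · rfl
    · rw [not_not] at he
      have h1 := hp.1 f e (by omega)
      have h2 := hp.1 e f (by omega)
      rw [coordDiff_swap] at h1
      linarith
  have hspan : vectorSpan ℝ (orderSimplex h) = LinearMap.range (extendByZero h) := by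
    refine le_antisymm ?_ ?_
    · refine Submodule.span_le.2 ?_
      rintro _ ⟨p, hp, q, hq, rfl⟩
      exact Submodule.sub_mem _ (hsub p hp) (hsub q hq)
    · rintro _ ⟨c, rfl⟩
      rw [← LinearMap.sum_single_apply (fun _ => ℝ) c, map_sum]
      refine Submodule.sum_mem _ fun e _ => ?_
      have hc : (Pi.single e (c e) : {e // h e ≠ 0} → ℝ) = c e • Pi.single e 1 := by
        rw [← Pi.single_smul, smul_eq_mul, mul_one]
      rw [hc, map_smul]
      refine Submodule.smul_mem _ _ ?_
      -- A unit vector of positive height is the difference of two vertices of the simplex.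
      have hdiff : extendByZero h (Pi.single e 1) =
          toTorus ({g | h e.1 ≤ h g}.indicator 1) - toTorus ({g | h e.1 < h g}.indicator 1) := by
        refine torus_ext f fun g => ?_
        rw [coordDiff_extendByZero h hf, map_sub, coordDiff_toTorus, coordDiff_toTorus]
        have hpos : 0 < h e.1 := Nat.pos_of_ne_zero e.2
        have n1 : f ∉ {g | h e.1 ≤ h g} := by simp only [mem_ofPred_eq]; omega
        have n2 : f ∉ {g | h e.1 < h g} := by simp only [mem_ofPred_eq]; omega
        rw [indicator_of_notMem n1, indicator_of_notMem n2]
        by_cases hge : g = e.1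
        · subst hge
          simp [e.2]
        · have hne : h e.1 ≠ h g := fun heq => hge (hinj _ _ heq e.2).symm
          have h1 : (if hg : h g ≠ 0 then (Pi.single e 1 : {e // h e ≠ 0} → ℝ) ⟨g, hg⟩ else 0)
              = 0 := by
            split_ifs with hg
            · exact Pi.single_eq_of_ne (fun heq => hge (congrArg Subtype.val heq)) _
            · rfl
          rw [h1]
          by_cases hlt : h e.1 < h g
          · simp [hlt, hlt.le]
          · have : ¬ h e.1 ≤ h g := by omega
            simp [hlt, this]
      rw [hdiff]
      exact vsub_mem_vectorSpan ℝ
        (indicator_upper_mem_orderSimplex h fun a b hab (ha : _ ≤ _) => ha.trans hab)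
        (indicator_upper_mem_orderSimplex h fun a b hab (ha : _ < _) => ha.trans_le hab)
  rw [cellDim, direction_affineSpan, hspan, LinearMap.finrank_range_of_inj hL,
    Module.finrank_fintype_fun_eq_card, Nat.card_eq_fintype_card]

end OrderSimplex

section MatroidCells

variable {E : Type*} {M : Matroid E}

/-! ### Types with respect to the bases of a matroid -/

/-- In a loopless matroid on a nonempty ground set, bases are nonempty. -/
theorem isBase_nonempty [Nonempty E] (hM : ∀ e f, M.Indep {e, f}) {B : Set E} (hB : M.IsBase B) :
    B.Nonempty := by
  obtain ⟨e⟩ := ‹Nonempty E›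
  obtain ⟨B', hB', h1, -⟩ := (hM e e).exists_isBase_subset_union_isBase hB
  by_contra hne
  rw [not_nonempty_iff_eq_empty] at hne
  have := hB.eq_of_subset_isBase hB' (by rw [hne]; exact empty_subset _)
  rw [← this, hne] at h1
  exact h1 (mem_insert e _)

variable {h : E → ℕ}

/-- In a simple matroid, elements `e` and `f` with `h e ≤ h f` lie in a common basis in which `f`
has the largest height, provided the elements of height `0` form a basis. -/
theorem exists_isBase_height_le (hM : ∀ e f, M.Indep {e, f})
    (hB : M.IsBase {e | h e = 0}) {e f : E} (hef : h e ≤ h f) :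
    ∃ B : BasesOf M, e ∈ B.1 ∧ f ∈ B.1 ∧ ∀ g ∈ B.1, h g ≤ h f := by
  obtain ⟨B, hB', h1, h2⟩ := (hM e f).exists_isBase_subset_union_isBase hB
  refine ⟨⟨B, hB'⟩, h1 (mem_insert _ _), h1 (mem_insert_of_mem _ rfl), fun g hg => ?_⟩
  rcases h2 hg with (rfl | rfl) | hg0
  · exact hef
  · exact le_rfl
  · rw [show h g = 0 from hg0]
    exact Nat.zero_le _

variable [Fintype E]

theorem mem_fineType_matroidGen_iff {p : TropTorus E} {e : E} {B : BasesOf M} :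
    B ∈ fineType (matroidGen M) p e ↔
      ∀ f, coordDiff f e p ≤ B.1.indicator 1 e - B.1.indicator 1 f := by
  rw [mem_fineType_iff]
  refine forall_congr' fun f => ?_
  rw [matroidGen, coordDiff_toTorus]
  simp only [Pi.neg_apply]
  rw [neg_sub_neg]

theorem fineType_zero_eq [Nonempty E] (hM : ∀ e f, M.Indep {e, f})
    (e : E) : fineType (matroidGen M) 0 e = {B | e ∈ B.1} := by
  ext B
  rw [mem_fineType_matroidGen_iff, mem_ofPred_eq]
  simp only [map_zero, sub_nonneg]
  constructor
  · intro hB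
    obtain ⟨f, hf⟩ := isBase_nonempty hM B.2
    by_contra he
    have := hB f
    rw [indicator_of_mem hf, indicator_of_notMem he] at this
    exact absurd this (by norm_num)
  · intro he f
    rw [indicator_of_mem he]
    exact indicator_le_self' (f := (1 : E → ℝ)) (fun _ _ => zero_le_one) f

/-- All points of an open order simplex have the same type: a basis belongs to the entry at its
elements of largest height. -/
theorem fineType_of_mem_openOrderSimplex [Nonempty E] (hM : ∀ e f, M.Indep {e, f})
    {p : TropTorus E} (hp : p ∈ openOrderSimplex h) (e : E) :
    fineType (matroidGen M) p e = {B | e ∈ B.1 ∧ ∀ f ∈ B.1, h f ≤ h e} := by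
  ext B
  rw [mem_fineType_matroidGen_iff, mem_ofPred_eq]
  constructor
  · intro hB
    have he : e ∈ B.1 := by
      obtain ⟨f, hf⟩ := isBase_nonempty hM B.2
      by_contra he
      have h1 := hB f
      have h2 := hp.2.2 e f
      rw [indicator_of_mem hf, indicator_of_notMem he, Pi.one_apply] at h1
      rw [coordDiff_swap] at h2
      linarith
    refine ⟨he, fun f hf => ?_⟩
    by_contra hlt
    have h1 := hB f
    have h2 := hp.2.1 e f (not_le.1 hlt)
    rw [indicator_of_mem hf, indicator_of_mem he, Pi.one_apply, Pi.one_apply, sub_self] at h1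
    rw [coordDiff_swap] at h2
    linarith
  · rintro ⟨he, hB⟩ f
    rw [indicator_of_mem he]
    by_cases hf : f ∈ B.1
    · rw [indicator_of_mem hf, Pi.one_apply, Pi.one_apply, sub_self]
      exact hp.1 f e (hB f hf)
    · rw [indicator_of_notMem hf, sub_zero]
      exact (hp.2.2 f e).le

/-- The type of the open order simplex cuts out the closed one. A basis containing `e` and `f` in
which `f` has the largest height forces `x_e ≤ x_f`; the basis of elements of height `0` forces the
bound by `1`. -/
theorem forall_mem_fineType_iff_mem_orderSimplex [Nonempty E] (hM : ∀ e f, M.Indep {e, f})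
    (hB : M.IsBase {e | h e = 0}) {p : TropTorus E} :
    (∀ e, {B : BasesOf M | e ∈ B.1 ∧ ∀ f ∈ B.1, h f ≤ h e} ⊆ fineType (matroidGen M) p e) ↔
      p ∈ orderSimplex h := by
  constructor
  · intro hp
    have hmono : ∀ e f, h e ≤ h f → coordDiff e f p ≤ 0 := by
      intro e f hef
      obtain ⟨B, he, hf, hBf⟩ := exists_isBase_height_le hM hB hef
      have := mem_fineType_matroidGen_iff.1 (hp f ⟨hf, hBf⟩) e
      rwa [indicator_of_mem hf, indicator_of_mem he, Pi.one_apply, Pi.one_apply, sub_self] at this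
    refine ⟨hmono, fun e f => ?_⟩
    obtain ⟨b, hb⟩ := isBase_nonempty hM hB
    have hb0 : h b = 0 := hb
    have h1 : (⟨_, hB⟩ : BasesOf M) ∈ fineType (matroidGen M) p b :=
      hp b ⟨hb, fun g (hg : h g = 0) => by omega⟩
    have h2 := mem_fineType_matroidGen_iff.1 h1 e
    have h3 := hmono b f (by omega)
    have h4 : 0 ≤ {e | h e = 0}.indicator (1 : E → ℝ) e :=
      indicator_nonneg (fun _ _ => zero_le_one) _
    rw [indicator_of_mem hb, Pi.one_apply] at h2
    rw [← coordDiff_add_coordDiff e b f]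
    linarith
  · rintro hp e B ⟨he, hBe⟩
    rw [mem_fineType_matroidGen_iff]
    intro f
    rw [indicator_of_mem he]
    by_cases hf : f ∈ B.1
    · rw [indicator_of_mem hf, Pi.one_apply, Pi.one_apply, sub_self]
      exact hp.1 f e (hBe f hf)
    · rw [indicator_of_notMem hf, sub_zero]
      exact hp.2 f e

theorem fineType_heightPoint_subset_iff [Nonempty E] (hM : ∀ e f, M.Indep {e, f})
    (hB : M.IsBase {e | h e = 0}) {p : TropTorus E} :
    (∀ e, fineType (matroidGen M) (heightPoint h) e ⊆ fineType (matroidGen M) p e) ↔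
      p ∈ orderSimplex h := by
  simp only [fineType_of_mem_openOrderSimplex hM (heightPoint_mem_openOrderSimplex h)]
  exact forall_mem_fineType_iff_mem_orderSimplex hM hB

theorem closure_openCell_heightPoint [Nonempty E] (hM : ∀ e f, M.Indep {e, f})
    (hB : M.IsBase {e | h e = 0}) :
    closure (openCell (matroidGen M) (fineType (matroidGen M) (heightPoint h))) =
      orderSimplex h := by
  rw [closure_openCell_fineType]
  ext p
  exact fineType_heightPoint_subset_iff hM hB

/-- If two coordinates of different height agreed, or a coordinate were larger by `1` than another,
some basis would belong to an additional entry of the type. -/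
theorem openCell_heightPoint [Nonempty E] (hM : ∀ e f, M.Indep {e, f})
    (hB : M.IsBase {e | h e = 0}) :
    openCell (matroidGen M) (fineType (matroidGen M) (heightPoint h)) = openOrderSimplex h := by
  ext p
  constructor
  · intro hp
    replace hp : fineType (matroidGen M) p = fineType (matroidGen M) (heightPoint h) := hp
    have hpS : p ∈ orderSimplex h :=
      (fineType_heightPoint_subset_iff hM hB).1 fun e => by rw [hp]
    have hT : ∀ e, fineType (matroidGen M) p e = {B | e ∈ B.1 ∧ ∀ f ∈ B.1, h f ≤ h e} := fun e => by
      rw [hp, fineType_of_mem_openOrderSimplex hM (heightPoint_mem_openOrderSimplex h)]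
    refine ⟨hpS.1, fun e f hef => ?_, fun e f => ?_⟩
    · by_contra hcon
      obtain ⟨B, he, hf, hBf⟩ := exists_isBase_height_le hM hB hef.le
      have h1 : B ∈ fineType (matroidGen M) p f := by rw [hT]; exact ⟨hf, hBf⟩
      have h2 : B ∈ fineType (matroidGen M) p e := by
        rw [mem_fineType_matroidGen_iff] at h1 ⊢
        intro g
        have h3 := h1 g
        rw [indicator_of_mem hf, Pi.one_apply] at h3
        rw [indicator_of_mem he, Pi.one_apply]
        rw [← coordDiff_add_coordDiff g f e]
        rw [coordDiff_swap] at hcon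
        linarith
      rw [hT] at h2
      have := h2.2 f hf
      omega
    · by_contra hcon
      rw [not_lt] at hcon
      obtain ⟨b, hb⟩ := isBase_nonempty hM hB
      have hb0 : h b = 0 := hb
      have h1 : (⟨_, hB⟩ : BasesOf M) ∈ fineType (matroidGen M) p b := by
        rw [hT]
        exact ⟨hb, fun g (hg : h g = 0) => by omega⟩
      have hbf := hpS.1 b f (by omega)
      have hbe : 1 ≤ coordDiff e b p := by
        have := coordDiff_add_coordDiff e b f p
        linarith
      have h2 : (⟨_, hB⟩ : BasesOf M) ∈ fineType (matroidGen M) p e := by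
        rw [mem_fineType_matroidGen_iff] at h1 ⊢
        intro g
        have h3 := h1 g
        have h4 : 0 ≤ {e | h e = 0}.indicator (1 : E → ℝ) e :=
          indicator_nonneg (fun _ _ => zero_le_one) _
        rw [indicator_of_mem hb, Pi.one_apply] at h3
        rw [← coordDiff_add_coordDiff g b e, coordDiff_swap e b]
        simp only at h3 ⊢
        linarith
      rw [hT] at h2
      have he0 : h e = 0 := h2.1
      have := hpS.1 e b (by omega)
      linarith
  · intro hp
    change fineType (matroidGen M) p = fineType (matroidGen M) (heightPoint h)
    ext1 e
    rw [fineType_of_mem_openOrderSimplex hM hp,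
      fineType_of_mem_openOrderSimplex hM (heightPoint_mem_openOrderSimplex h)]

theorem isCell_orderSimplex [Nonempty E] (hM : ∀ e f, M.Indep {e, f})
    (hB : M.IsBase {e | h e = 0}) :
    IsCell (matroidGen M) (orderSimplex h) :=
  ⟨heightPoint h, (closure_openCell_heightPoint hM hB).symm⟩

/-! ### Pseudovertices and tropical vertices -/

theorem isPseudovertex_of_forall_eq [Nonempty E] {p : TropTorus E}
    (hp : ∀ q, (∀ e, fineType (matroidGen M) p e ⊆ fineType (matroidGen M) q e) → q = p) :
    IsPseudovertex (matroidGen M) p := by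
  have : closure (openCell (matroidGen M) (fineType (matroidGen M) p)) = {p} := by
    rw [closure_openCell_fineType]
    ext q
    rw [mem_singleton_iff, mem_ofPred_eq]
    exact ⟨hp q, fun h e => by rw [h]⟩
  refine ⟨{p}, ⟨p, this.symm⟩, ?_, rfl⟩
  rw [cellDim, direction_affineSpan, vectorSpan_singleton, finrank_bot]

/-- The vertices of the order simplex are pseudovertices: their types force every coordinate. -/
theorem isPseudovertex_indicator [Nonempty E] (hM : ∀ e f, M.Indep {e, f})
    (hB : M.IsBase {e | h e = 0}) (s : ℕ) :
    IsPseudovertex (matroidGen M) (toTorus ({e | s < h e}.indicator 1)) := by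
  refine isPseudovertex_of_forall_eq fun q hq => ?_
  set p : TropTorus E := toTorus ({e | s < h e}.indicator 1) with hp
  have hpS : p ∈ orderSimplex h :=
    indicator_upper_mem_orderSimplex h fun a b hab (ha : _ < _) => ha.trans_le hab
  have hqS : q ∈ orderSimplex h := (fineType_heightPoint_subset_iff hM hB).1 fun e =>
    ((fineType_heightPoint_subset_iff hM hB).2 hpS e).trans (hq e)
  obtain ⟨b, hb⟩ := isBase_nonempty hM hB
  have hb0 : h b = 0 := hb
  have hbp : b ∉ {e | s < h e} := by simp only [mem_ofPred_eq]; omega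
  refine torus_ext b fun e => ?_
  rw [hp, coordDiff_toTorus, indicator_of_notMem hbp, sub_zero]
  by_cases he : e ∈ {e | s < h e}
  · rw [indicator_of_mem he, Pi.one_apply]
    refine le_antisymm (hqS.2 e b) ?_
    have heB : e ∉ {e | h e = 0} := by
      simp only [mem_ofPred_eq] at *
      omega
    have h1 : (⟨_, hB⟩ : BasesOf M) ∈ fineType (matroidGen M) p e := by
      rw [mem_fineType_matroidGen_iff]
      intro f
      rw [hp, coordDiff_toTorus, indicator_of_mem he, indicator_of_notMem heB]
      by_cases hf : f ∈ {e | h e = 0}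
      · have hfp : f ∉ {e | s < h e} := by
          simp only [mem_ofPred_eq] at *
          omega
        rw [indicator_of_mem hf, indicator_of_notMem hfp]
        simp
      · rw [indicator_of_notMem hf, sub_zero, sub_nonpos]
        exact indicator_le_self' (f := (1 : E → ℝ)) (fun _ _ => zero_le_one) f
    have h2 := mem_fineType_matroidGen_iff.1 (hq e h1) b
    rw [indicator_of_mem hb, indicator_of_notMem heB, Pi.one_apply, coordDiff_swap] at h2
    linarith
  · rw [indicator_of_notMem he]
    refine le_antisymm ?_ ?_
    · obtain ⟨B, hbB, heB, hBe⟩ := exists_isBase_height_le hM hB (e := b) (f := e) (by omega)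
      have h1 : B ∈ fineType (matroidGen M) p b := by
        rw [mem_fineType_matroidGen_iff]
        intro f
        rw [hp, coordDiff_toTorus, indicator_of_notMem hbp, indicator_of_mem hbB, sub_zero]
        by_cases hf : f ∈ B.1
        · have hfp : f ∉ {e | s < h e} := by
            have := hBe f hf
            simp only [mem_ofPred_eq] at *
            omega
          rw [indicator_of_notMem hfp, indicator_of_mem hf, Pi.one_apply, Pi.one_apply, sub_self]
        · rw [indicator_of_notMem hf, sub_zero]
          exact indicator_le_self' (f := (1 : E → ℝ)) (fun _ _ => zero_le_one) f
      have h2 := mem_fineType_matroidGen_iff.1 (hq b h1) e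
      rwa [indicator_of_mem hbB, indicator_of_mem heB, Pi.one_apply, Pi.one_apply, sub_self] at h2
    · have := hqS.1 b e (by omega)
      rw [coordDiff_swap] at this
      linarith

/-- All generators are needed: for `b ∈ B`, the complement of the closed sector of `v_B` in
direction `b` is tropically convex and contains every `v_{B'}` with `B' ≠ B`. -/
theorem isTropVertex_matroidGen [Nonempty E] (hM : ∀ e f, M.Indep {e, f})
    (B : BasesOf M) :
    IsTropVertex (tropMatroidPolytope M) (matroidGen M B) := by
  refine ⟨range (matroidGen M), ⟨rfl, ?_⟩, ⟨B, rfl⟩⟩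
  intro W hW hWsub
  rintro _ ⟨B, rfl⟩
  by_contra hBW
  obtain ⟨b, hb⟩ := isBase_nonempty hM B.2
  let C : Set (TropTorus E) := {p | ∃ f, coordDiff f b p < 1 - B.1.indicator 1 f}
  have hWC : W ⊆ C := by
    intro p hp
    obtain ⟨B', rfl⟩ := hWsub hp
    have hne : ¬ B'.1 ⊆ B.1 := fun hsub =>
      hBW (by rwa [← Subtype.ext (B'.2.eq_of_subset_isBase B.2 hsub)])
    obtain ⟨f, hf', hf⟩ := not_subset.1 hne
    refine ⟨f, ?_⟩
    rw [matroidGen, coordDiff_toTorus, Pi.neg_apply, Pi.neg_apply, indicator_of_mem hf',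
      indicator_of_notMem hf, Pi.one_apply]
    have : B'.1.indicator (1 : E → ℝ) b ≤ 1 :=
      indicator_le_self' (f := (1 : E → ℝ)) (fun _ _ => zero_le_one) b
    linarith
  have hmem : matroidGen M B ∈ tconv W := by
    rw [show tconv W = tconv (range (matroidGen M)) from hW]
    exact subset_tconv _ ⟨B, rfl⟩
  obtain ⟨f, hf⟩ := tconv_subset (isTropConvex_exists_coordDiff_lt b _) hWC hmem
  rw [matroidGen, coordDiff_toTorus, Pi.neg_apply, Pi.neg_apply, indicator_of_mem hb,
    Pi.one_apply] at hf
  linarith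

end MatroidCells

/-! ### Sequences of elements and maximal bounded cells -/

section Sequences

variable {E : Type*}

open Classical in
/-- The height of an element with respect to a sequence: it is `r` for the first term of the
sequence, decreases by `1` from each term to the next, and is `0` off the sequence. -/
noncomputable def seqHeight {r : ℕ} (i : Fin r → E) (e : E) : ℕ :=
  (Finset.univ.filter fun l : Fin r => ∃ j ≤ l, i j = e).card

theorem seqHeight_apply {r : ℕ} {i : Fin r → E} (hi : Function.Injective i) (j : Fin r) :
    seqHeight i (i j) = r - j := by
  classical
  rw [seqHeight, ← Fin.card_Ici]
  congr 1
  ext l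
  simp [hi.eq_iff]

theorem seqHeight_le {r : ℕ} (i : Fin r → E) (e : E) : seqHeight i e ≤ r := by
  classical
  exact (Finset.card_le_univ _).trans_eq (Fintype.card_fin r)

theorem seqHeight_of_notMem {r : ℕ} {i : Fin r → E} {e : E} (he : e ∉ range i) :
    seqHeight i e = 0 := by
  classical
  rw [seqHeight, Finset.card_eq_zero, Finset.filter_eq_empty_iff]
  rintro l - ⟨j, -, hj⟩
  exact he ⟨j, hj⟩

theorem setOf_seqHeight_eq_zero {r : ℕ} {i : Fin r → E} (hi : Function.Injective i) :
    {e | seqHeight i e = 0} = (range i)ᶜ := by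
  ext e
  constructor
  · rintro he ⟨j, rfl⟩
    have h0 : seqHeight i (i j) = 0 := he
    rw [seqHeight_apply hi] at h0
    omega
  · exact seqHeight_of_notMem

theorem seqHeight_injOn {r : ℕ} {i : Fin r → E} (hi : Function.Injective i) (e f : E)
    (hef : seqHeight i e = seqHeight i f) (he : seqHeight i e ≠ 0) : e = f := by
  have h1 : e ∈ range i := by
    by_contra h
    exact he (seqHeight_of_notMem h)
  have h2 : f ∈ range i := by
    by_contra h
    exact he (hef.trans (seqHeight_of_notMem h))
  obtain ⟨j, rfl⟩ := h1
  obtain ⟨l, rfl⟩ := h2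
  rw [seqHeight_apply hi, seqHeight_apply hi] at hef
  congr 1
  ext
  omega

variable [Fintype E]

theorem seqPoint_eq {r : ℕ} {i : Fin r → E} (hi : Function.Injective i) (j : Fin (r + 1)) :
    seqPoint i j = toTorus ({e | r - j < seqHeight i e}.indicator 1) := by
  rw [seqPoint]
  congr 2
  ext e
  constructor
  · rintro ⟨l, hl, rfl⟩
    rw [mem_ofPred_eq, seqHeight_apply hi]
    omega
  · intro he
    rw [mem_ofPred_eq] at he
    have h1 : e ∈ range i := by
      by_contra h
      rw [seqHeight_of_notMem h] at he
      omega
    obtain ⟨l, rfl⟩ := h1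
    rw [seqHeight_apply hi] at he
    exact ⟨l, by omega, rfl⟩

theorem tconv_range_seqPoint [Nonempty E] {r : ℕ} {i : Fin r → E} (hi : Function.Injective i)
    (hne : (range i)ᶜ.Nonempty) : tconv (range (seqPoint i)) = orderSimplex (seqHeight i) := by
  rw [orderSimplex_eq_tconv]
  congr 1
  ext p
  constructor
  · rintro ⟨j, rfl⟩
    rw [seqPoint_eq hi]
    rcases Nat.lt_or_ge j r with hj | hj
    · exact ⟨i ⟨j, hj⟩, by simp only [seqHeight_apply hi]⟩
    · obtain ⟨b, hb⟩ := hne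
      refine ⟨b, ?_⟩
      simp only [seqHeight_of_notMem hb, Nat.sub_eq_zero_of_le hj]
  · rintro ⟨f, rfl⟩
    refine ⟨⟨r - seqHeight i f, by omega⟩, ?_⟩
    rw [seqPoint_eq hi]
    simp only [Nat.sub_sub_self (seqHeight_le i f)]

/-- An order simplex determines the sequence: its interior points have their coordinates
ordered as the sequence. -/
theorem seq_eq_of_orderSimplex_subset {r : ℕ} {i i' : Fin r → E} (hi : Function.Injective i)
    (hi' : Function.Injective i') (hne : (range i)ᶜ.Nonempty)
    (hsub : orderSimplex (seqHeight i) ⊆ orderSimplex (seqHeight i')) : i = i' := by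
  have hz := hsub (openOrderSimplex_subset _ (heightPoint_mem_openOrderSimplex (seqHeight i)))
  have hmono : ∀ e f, seqHeight i' e ≤ seqHeight i' f → seqHeight i e ≤ seqHeight i f :=
    fun e f hef => (coordDiff_heightPoint_nonpos_iff _).1 (hz.1 e f hef)
  have hrange : range i ⊆ range i' := by
    rintro _ ⟨j, rfl⟩
    by_contra hcon
    obtain ⟨b, hb⟩ := hne
    have h1 := hmono (i j) b (by rw [seqHeight_of_notMem hcon]; exact Nat.zero_le _)
    rw [seqHeight_of_notMem hb, seqHeight_apply hi] at h1
    omega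
  choose σ hσ using fun j => hrange ⟨j, rfl⟩
  have hσinj : Function.Injective σ := fun a b hab => hi (by rw [← hσ a, ← hσ b, hab])
  have hσsurj : Function.Surjective σ := Finite.surjective_of_injective hσinj
  have hσmono : StrictMono σ := by
    intro a b hab
    by_contra hcon
    have h1 := hmono (i a) (i b) (by
      rw [← hσ a, ← hσ b, seqHeight_apply hi', seqHeight_apply hi']
      have : (σ b : ℕ) ≤ σ a := not_lt.1 hcon
      omega)
    rw [seqHeight_apply hi, seqHeight_apply hi] at h1
    have : (a : ℕ) < b := hab
    omega
  have hid : σ = id := (hσmono.range_inj strictMono_id).1 (by rw [hσsurj.range_eq, range_id])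
  ext j
  rw [← hσ j, hid, id]

variable {M : Matroid E}

/-- If every sector based at `p` contains a generator, then the coordinates of `p` differ by at
most `1` and the minimal ones contain a basis `B`; listing the complement of `B` by decreasing
coordinates gives an order simplex containing `p`. -/
theorem exists_mem_orderSimplex_seqHeight [Nonempty E] (hM : ∀ e f, M.Indep {e, f}) {r : ℕ}
    (hr : ∀ B, M.IsBase B → Nat.card ↥Bᶜ = r) {p : TropTorus E}
    (hp : ∀ e, (fineType (matroidGen M) p e).Nonempty) :
    ∃ i : Fin r → E, (Function.Injective i ∧ M.IsBase (range i)ᶜ) ∧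
      p ∈ orderSimplex (seqHeight i) := by
  obtain ⟨x, rfl⟩ := toTorus_surjective p
  obtain ⟨e₀, he₀⟩ := Finite.exists_min x
  obtain ⟨⟨B, hB⟩, hBT⟩ := hp e₀
  simp only [mem_fineType_matroidGen_iff, coordDiff_toTorus] at hBT
  have he₀B : e₀ ∈ B := by
    by_contra hcon
    obtain ⟨f, hf⟩ := isBase_nonempty hM hB
    have h1 := hBT f
    rw [indicator_of_mem hf, indicator_of_notMem hcon, Pi.one_apply] at h1
    have := he₀ f
    linarith
  have hBmin : ∀ f ∈ B, x f = x e₀ := by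
    intro f hf
    have h1 := hBT f
    rw [indicator_of_mem hf, indicator_of_mem he₀B, Pi.one_apply, Pi.one_apply] at h1
    have := he₀ f
    linarith
  have hmax : ∀ f, x f ≤ x e₀ + 1 := by
    intro f
    have h1 := hBT f
    rw [indicator_of_mem he₀B, Pi.one_apply] at h1
    have h2 : 0 ≤ B.indicator (1 : E → ℝ) f := indicator_nonneg (fun _ _ => zero_le_one) _
    linarith
  let σ : Fin r ≃ ↥Bᶜ := (Finite.equivFinOfCardEq (hr B hB)).symm
  let g : Fin r → ℝ := fun l => -x (σ l)
  have hsort := Tuple.monotone_sort g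
  let i : Fin r → E := fun l => σ (Tuple.sort g l)
  have hi : Function.Injective i :=
    Subtype.val_injective.comp (σ.injective.comp (Tuple.sort g).injective)
  have hrange : range i = Bᶜ := by
    ext e
    constructor
    · rintro ⟨l, rfl⟩
      exact (σ _).2
    · intro he
      exact ⟨(Tuple.sort g).symm (σ.symm ⟨e, he⟩), by simp [i]⟩
  refine ⟨i, ⟨hi, by rwa [hrange, compl_compl]⟩, fun e f hef => ?_, fun e f => ?_⟩
  · rw [coordDiff_toTorus, sub_nonpos]
    by_cases he : e ∈ B
    · rw [hBmin e he]
      exact he₀ f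
    · have he' : e ∈ range i := by rwa [hrange]
      obtain ⟨l, rfl⟩ := he'
      rw [seqHeight_apply hi] at hef
      have hf : f ∈ range i := by
        by_contra hcon
        rw [seqHeight_of_notMem hcon] at hef
        omega
      obtain ⟨m, rfl⟩ := hf
      rw [seqHeight_apply hi] at hef
      exact neg_le_neg_iff.1 (hsort (show m ≤ l from Fin.le_def.2 (by omega)))
  · rw [coordDiff_toTorus]
    have h1 := hmax e
    have h2 := he₀ f
    linarith

theorem isMaxBoundedCell_iff [Nonempty E] (hM : ∀ e f, M.Indep {e, f}) {r : ℕ}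
    (hr : ∀ B, M.IsBase B → Nat.card ↥Bᶜ = r) {C : Set (TropTorus E)} :
    IsMaxBoundedCell (matroidGen M) C ↔ ∃ i : Fin r → E,
      (Function.Injective i ∧ M.IsBase (range i)ᶜ) ∧ C = orderSimplex (seqHeight i) := by
  have hbase : ∀ i : Fin r → E, Function.Injective i ∧ M.IsBase (range i)ᶜ →
      M.IsBase {e | seqHeight i e = 0} := fun i hi => by
    rw [setOf_seqHeight_eq_zero hi.1]
    exact hi.2
  have hcell : ∀ i : Fin r → E, Function.Injective i ∧ M.IsBase (range i)ᶜ →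
      IsCell (matroidGen M) (orderSimplex (seqHeight i)) ∧
        Bornology.IsBounded (orderSimplex (seqHeight i)) := fun i hi =>
    ⟨isCell_orderSimplex hM (hbase i hi), isBounded_of_coordDiff_le_one fun p hp => hp.2⟩
  have hcover : ∀ C, IsCell (matroidGen M) C → Bornology.IsBounded C →
      ∃ i : Fin r → E, (Function.Injective i ∧ M.IsBase (range i)ᶜ) ∧
        C ⊆ orderSimplex (seqHeight i) := by
    rintro _ ⟨p, rfl⟩ hb
    have : Nonempty (BasesOf M) := by
      obtain ⟨B, hB⟩ := M.exists_isBase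
      exact ⟨⟨B, hB⟩⟩
    obtain ⟨i, hi, hpi⟩ := exists_mem_orderSimplex_seqHeight hM hr
      (fineType_nonempty_of_isBounded (hb.subset subset_closure))
    refine ⟨i, hi, ?_⟩
    rw [closure_openCell_fineType]
    exact fun q hq => (fineType_heightPoint_subset_iff hM (hbase i hi)).1 fun e =>
      ((fineType_heightPoint_subset_iff hM (hbase i hi)).2 hpi e).trans (hq e)
  constructor
  · intro hC
    obtain ⟨i, hi, hCi⟩ := hcover C hC.1.1 hC.1.2
    exact ⟨i, hi, hCi.antisymm (hC.2 (hcell i hi) hCi)⟩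
  · rintro ⟨i, hi, rfl⟩
    refine ⟨hcell i hi, fun C' hC' hsub => ?_⟩
    obtain ⟨i', hi', hCi'⟩ := hcover C' hC'.1 hC'.2
    rwa [← seq_eq_of_orderSimplex_subset hi.1 hi'.1 (isBase_nonempty hM hi.2)
      (hsub.trans hCi')] at hCi'

/-- The sequences of distinct elements whose complement is a basis are the enumerations of the
complements of bases. -/
theorem card_seq_isBase_compl {r : ℕ} (hr : ∀ B, M.IsBase B → Nat.card ↥Bᶜ = r) :
    Nat.card {i : Fin r → E // Function.Injective i ∧ M.IsBase (range i)ᶜ} =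
      Nat.card (BasesOf M) * r ! := by
  classical
  have hrange : ∀ s : Σ B : BasesOf M, (Fin r ≃ ↥(B.1)ᶜ),
      (range fun l => (s.2 l : E))ᶜ = s.1.1 := by
    intro s
    rw [← Function.comp_def, s.2.surjective.range_comp, Subtype.range_coe, compl_compl]
  let Φ : (Σ B : BasesOf M, (Fin r ≃ ↥(B.1)ᶜ)) →
      {i : Fin r → E // Function.Injective i ∧ M.IsBase (range i)ᶜ} := fun s =>
    ⟨fun l => s.2 l, Subtype.val_injective.comp s.2.injective, by rw [hrange s]; exact s.1.2⟩
  have hΦ : Function.Bijective Φ := by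
    constructor
    · rintro ⟨⟨B, hB⟩, τ⟩ ⟨⟨B', hB'⟩, τ'⟩ hs
      have hfun : ∀ l, (τ l : E) = τ' l := fun l => congrFun (congrArg Subtype.val hs) l
      obtain rfl : B = B' := by
        calc B = (range fun l => (τ l : E))ᶜ := (hrange ⟨⟨B, hB⟩, τ⟩).symm
          _ = (range fun l => (τ' l : E))ᶜ := by simp only [hfun]
          _ = B' := hrange ⟨⟨B', hB'⟩, τ'⟩
      congr 1
      ext l
      exact hfun l
    · rintro ⟨i, hi, hB⟩
      exact ⟨⟨⟨_, hB⟩, (Equiv.ofInjective i hi).trans (Equiv.setCongr (compl_compl _).symm)⟩, rfl⟩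
  have : Fintype (BasesOf M) := Fintype.ofFinite _
  rw [← Nat.card_congr (Equiv.ofBijective Φ hΦ), Nat.card_eq_fintype_card, Fintype.card_sigma]
  have hfib : ∀ B : BasesOf M, Fintype.card (Fin r ≃ ↥(B.1)ᶜ) = r ! := by
    intro B
    rw [Fintype.card_equiv (Finite.equivFinOfCardEq (hr B.1 B.2)).symm, Fintype.card_fin]
  simp only [hfib, Finset.sum_const, Finset.card_univ, smul_eq_mul, Nat.card_eq_fintype_card]

end Sequences

/-! ### Graphic matroids -/

section GraphicMatroid

variable {V : Type*} (G : SimpleGraph V)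

theorem graphicMatroid_indep_iff [Finite G.edgeSet] {F : Set G.edgeSet} :
    (graphicMatroid G).Indep F ↔ (edgeSubgraph G F).IsAcyclic := by
  rw [graphicMatroid, IndepMatroid.matroid_indep_iff, IndepMatroid.ofBdd_indep]

/-- A cycle of a simple graph has at least three edges, so graphic matroids are simple. -/
theorem graphicMatroid_indep_pair [Finite G.edgeSet] (e f : G.edgeSet) :
    (graphicMatroid G).Indep {e, f} := by
  classical
  rw [graphicMatroid_indep_iff]
  intro u c hc
  have hsub : c.edges.toFinset ⊆ {e.1, f.1} := by
    intro a ha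
    have ha' := c.edges_subset_edgeSet (List.mem_toFinset.1 ha)
    rw [edgeSubgraph, SimpleGraph.edgeSet_fromEdgeSet] at ha'
    obtain ⟨⟨b, hb, rfl⟩, -⟩ := ha'
    rcases hb with rfl | rfl <;> simp
  have h1 := (Finset.card_le_card hsub).trans Finset.card_le_two
  rw [List.toFinset_card_of_nodup hc.edges_nodup, SimpleGraph.Walk.length_edges] at h1
  have := hc.three_le_length
  omega

theorem graphicMatroid_isBase_iff [Finite G.edgeSet] (hconn : G.Connected) {F : Set G.edgeSet} :
    (graphicMatroid G).IsBase F ↔ (edgeSubgraph G F).IsTree := by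
  have hind : (graphicMatroid G).Indep = fun F => (edgeSubgraph G F).IsAcyclic := by
    ext F
    exact graphicMatroid_indep_iff G
  rw [Matroid.isBase_iff_maximal_indep, hind, maximal_edgeSubgraph_iff,
    SimpleGraph.isTree_iff, and_comm]
  refine and_congr_left fun _ => ?_
  constructor
  · intro h
    have := hconn.nonempty
    refine ⟨fun a b => ?_⟩
    rw [h]
    exact hconn.preconnected a b
  · intro h
    ext a b
    exact iff_of_true (h.preconnected a b) (hconn.preconnected a b)

theorem isValidSeq_iff [Fintype G.edgeSet] (hconn : G.Connected) {r : ℕ}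
    (hr : ∀ B, (graphicMatroid G).IsBase B → Nat.card ↥Bᶜ = r) {i : Fin r → G.edgeSet} :
    IsValidSeq G i ↔ Function.Injective i ∧ (graphicMatroid G).IsBase (range i)ᶜ := by
  refine and_congr_right fun hi => ?_
  constructor
  · rintro ⟨F, hF, htree⟩
    have hB := (graphicMatroid_isBase_iff G hconn).2 htree
    have hsub : range i ⊆ Fᶜ := subset_compl_comm.1 hF
    -- The spanning tree fills the whole complement, by cardinality.
    have heq : range i = Fᶜ := by
      refine eq_of_subset_of_ncard_le hsub ?_
      rw [← Nat.card_coe_set_eq, ← Nat.card_coe_set_eq, hr F hB, Nat.card_range_of_injective hi,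
        Nat.card_fin]
    rwa [heq, compl_compl]
  · intro hB
    exact ⟨_, Subset.rfl, (graphicMatroid_isBase_iff G hconn).1 hB⟩

end GraphicMatroid

theorem mainTheorem5 {V : Type*} [Finite V] (G : SimpleGraph V) [Fintype G.edgeSet]
    (hconn : G.Connected) (hbridge : ∀ e ∈ G.edgeSet, ¬ G.IsBridge e)
    (k d n : ℕ)
    (hd : Fintype.card G.edgeSet = d + 1)
    (hk : (graphicMatroid G).eRank = (k : ℕ∞))
    (hn : Nat.card (BasesOf (graphicMatroid G)) = n) :
    -- every maximal bounded cell has dimension `d - k + 1`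
    (∀ C, IsMaxBoundedCell (matroidGen (graphicMatroid G)) C → cellDim C = d + 1 - k) ∧
    -- the maximal bounded cells are the hulls of the valid sequences
    (∀ C, IsMaxBoundedCell (matroidGen (graphicMatroid G)) C ↔
      ∃ i : Fin (d + 1 - k) → G.edgeSet, IsValidSeq G i ∧
        C = tconv (Set.range (seqPoint i))) ∧
    -- description of the cell of a valid sequence
    (∀ i : Fin (d + 1 - k) → G.edgeSet, IsValidSeq G i →
      (∀ j, IsPseudovertex (matroidGen (graphicMatroid G)) (seqPoint i j)) ∧
      (∃ B : BasesOf (graphicMatroid G), B.1 = (Set.range i)ᶜ ∧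
        seqPoint i (Fin.last _) = matroidGen (graphicMatroid G) B ∧
        IsTropVertex (tropMatroidPolytope (graphicMatroid G))
          (matroidGen (graphicMatroid G) B)) ∧
      ∃ T : G.edgeSet → Set (BasesOf (graphicMatroid G)),
        (∀ j, T (i j) = fineType (matroidGen (graphicMatroid G)) 0 (i j) \
          ⋃ l, ⋃ (_ : l < j), fineType (matroidGen (graphicMatroid G)) 0 (i l)) ∧
        (∀ b ∉ Set.range i, T b = fineType (matroidGen (graphicMatroid G)) 0 b \
          ⋃ l, fineType (matroidGen (graphicMatroid G)) 0 (i l)) ∧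
        closure (openCell (matroidGen (graphicMatroid G)) T) = tconv (Set.range (seqPoint i)) ∧
        openCell (matroidGen (graphicMatroid G)) T =
          intrinsicInterior ℝ (tconv (Set.range (seqPoint i)))) ∧
    -- the number of maximal bounded cells
    {C | IsMaxBoundedCell (matroidGen (graphicMatroid G)) C}.ncard = n * (d + 1 - k)! := by
  have hne : Nonempty G.edgeSet := Fintype.card_pos_iff.1 (by omega)
  have hM := graphicMatroid_indep_pair G
  have hr : ∀ B, (graphicMatroid G).IsBase B → Nat.card ↥Bᶜ = d + 1 - k := by
    intro B hB
    have h1 : B.ncard = k := by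
      rw [Set.ncard, hB.encard_eq_eRank, hk]
      rfl
    rw [Nat.card_coe_set_eq, Set.ncard_compl, h1, Nat.card_eq_fintype_card, hd]
  have hvalid : ∀ i : Fin (d + 1 - k) → G.edgeSet, IsValidSeq G i ↔
      Function.Injective i ∧ (graphicMatroid G).IsBase (range i)ᶜ :=
    fun i => isValidSeq_iff G hconn hr
  have hbase : ∀ i : Fin (d + 1 - k) → G.edgeSet, IsValidSeq G i →
      (graphicMatroid G).IsBase {e | seqHeight i e = 0} := fun i hi => by
    rw [setOf_seqHeight_eq_zero hi.1]
    exact ((hvalid i).1 hi).2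
  have htconv : ∀ i : Fin (d + 1 - k) → G.edgeSet, IsValidSeq G i →
      tconv (range (seqPoint i)) = orderSimplex (seqHeight i) := fun i hi =>
    tconv_range_seqPoint hi.1 (isBase_nonempty hM ((hvalid i).1 hi).2)
  refine ⟨fun C hC => ?_, fun C => ?_, fun i hi => ⟨fun j => ?_, ?_, ?_⟩, ?_⟩
  · obtain ⟨i, hi, rfl⟩ := (isMaxBoundedCell_iff hM hr).1 hC
    obtain ⟨b, hb⟩ := isBase_nonempty hM hi.2
    rw [cellDim_orderSimplex ⟨b, seqHeight_of_notMem hb⟩ (seqHeight_injOn hi.1)]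
    have h0 : {e | seqHeight i e ≠ 0} = range i := by
      rw [← compl_compl (range i), ← setOf_seqHeight_eq_zero hi.1]
      rfl
    have h1 : Nat.card ↥{e | seqHeight i e ≠ 0} = d + 1 - k := by
      rw [h0, Nat.card_range_of_injective hi.1, Nat.card_fin]
    exact h1
  · rw [isMaxBoundedCell_iff hM hr]
    refine exists_congr fun i => ?_
    rw [← hvalid i]
    exact and_congr_right fun hi => by rw [htconv i hi]
  · rw [seqPoint_eq hi.1]
    exact isPseudovertex_indicator hM (hbase i hi) _
  · refine ⟨⟨_, ((hvalid i).1 hi).2⟩, rfl, ?_, isTropVertex_matroidGen hM _⟩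
    -- The representatives `e_{E ∖ B}` and `-e_B` differ by the all-ones vector.
    refine toTorus_eq_iff.2 ⟨1, fun e => ?_⟩
    by_cases he : e ∈ range i
    · have he' : e ∈ {e | ∃ l : Fin (d + 1 - k),
          l.val < (Fin.last (d + 1 - k)).val ∧ i l = e} := by
        obtain ⟨l, rfl⟩ := he
        exact ⟨l, l.2, rfl⟩
      rw [indicator_of_mem he', Pi.neg_apply, indicator_of_notMem (not_not.2 he)]
      simp
    · have he' : e ∉ {e | ∃ l : Fin (d + 1 - k),
          l.val < (Fin.last (d + 1 - k)).val ∧ i l = e} := by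
        rintro ⟨l, -, rfl⟩
        exact he ⟨l, rfl⟩
      rw [indicator_of_notMem he', Pi.neg_apply, indicator_of_mem (mem_compl he)]
      simp
  · refine ⟨fineType (matroidGen (graphicMatroid G)) (heightPoint (seqHeight i)), fun j => ?_,
      fun b hb => ?_, ?_, ?_⟩
    · rw [fineType_of_mem_openOrderSimplex hM (heightPoint_mem_openOrderSimplex _)]
      simp only [fineType_zero_eq hM]
      ext B
      simp only [mem_ofPred_eq, mem_sdiff, mem_iUnion, not_exists]
      refine and_congr_right fun _ => ?_
      constructor
      · intro h l hl hlB
        have := h _ hlB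
        rw [seqHeight_apply hi.1, seqHeight_apply hi.1] at this
        have : l.val < j.val := hl
        omega
      · intro h f hf
        by_cases hfi : f ∈ range i
        · obtain ⟨l, rfl⟩ := hfi
          have : ¬ l.val < j.val := fun hl => h l hl hf
          rw [seqHeight_apply hi.1, seqHeight_apply hi.1]
          omega
        · rw [seqHeight_of_notMem hfi]
          exact Nat.zero_le _
    · rw [fineType_of_mem_openOrderSimplex hM (heightPoint_mem_openOrderSimplex _)]
      simp only [fineType_zero_eq hM]
      ext B
      simp only [mem_ofPred_eq, mem_sdiff, mem_iUnion, not_exists]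
      refine and_congr_right fun _ => ?_
      rw [seqHeight_of_notMem hb]
      constructor
      · intro h l hlB
        have := h _ hlB
        rw [seqHeight_apply hi.1] at this
        omega
      · intro h f hf
        rw [seqHeight_of_notMem]
        rintro ⟨l, rfl⟩
        exact h l hf
    · rw [closure_openCell_heightPoint hM (hbase i hi), htconv i hi]
    · rw [openCell_heightPoint hM (hbase i hi), htconv i hi, intrinsicInterior_orderSimplex]
  · have hset : {C | IsMaxBoundedCell (matroidGen (graphicMatroid G)) C} =
        range fun i : {i : Fin (d + 1 - k) → G.edgeSet //
          Function.Injective i ∧ (graphicMatroid G).IsBase (range i)ᶜ} =>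
            orderSimplex (seqHeight i.1) := by
      ext C
      rw [mem_ofPred_eq, isMaxBoundedCell_iff hM hr]
      constructor
      · rintro ⟨i, hi, rfl⟩
        exact ⟨⟨i, hi⟩, rfl⟩
      · rintro ⟨i, rfl⟩
        exact ⟨i.1, i.2, rfl⟩
    have hinj : Function.Injective fun i : {i : Fin (d + 1 - k) → G.edgeSet //
        Function.Injective i ∧ (graphicMatroid G).IsBase (range i)ᶜ} =>
          orderSimplex (seqHeight i.1) := fun i i' h =>
      Subtype.ext (seq_eq_of_orderSimplex_subset i.2.1 i'.2.1 (isBase_nonempty hM i.2.2) h.le)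
    rw [hset, ← Nat.card_coe_set_eq, Nat.card_range_of_injective hinj, card_seq_isBase_compl hr, hn]
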